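/- Fix $k\ge 1$, a positive definite matrix $\Sigma\in\mathbb R^{k\times k}$, $0<d<1$, $0<\alpha<1/2$, $\alpha<\beta<1$ and $\rho>0$. Write $\|x\|_\Sigma^2=x^T\Sigma^{-1}x$, let $\chi^2_{k,\gamma}$ denote the upper $\gamma$-quantile of the chi-square distribution with $k$ degrees of freedom, and let $L>\chi^2_{k,\alpha}\,(\chi^2_{k,\beta})^{-d/(1+\rho)}$. For $c>0$ consider the Bayesian model with Exponential-Inverse-Gamma prior: $X\mid\theta\sim N_k(\theta,\Sigma)$, $\theta\mid\lambda^2,\tau\sim N_k(0,\lambda^2\tau\Sigma)$, where $\lambda^2$ and $\tau$ are independent with densities on $(0,\infty)$ proportional to $e^{-\lambda^2/2}$ and $\tau^{-d-1}e^{-c/(2\tau)}$ respectively. Let $\Pi(\cdot\mid X)$ be the posterior law of $\theta$ (given by Bayes' formula), $\widehat\theta^{EIG}=E(\theta\mid X)$ its mean, $\widehat r(\alpha,c)$ the $(1-\alpha)$-quantile of $\|\theta-\widehat\theta^{EIG}\|_\Sigma^2$ under $\Pi(\cdot\mid X)$, and $$\widehat C^{EIG}=\{\theta\in\mathbb R^k:\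 \|\theta-\widehat\theta^{EIG}\|_\Sigma^2\le L\,\widehat r(\alpha,c)^{d/(1+\rho)}\}.$$ Let $c_n>0$ with $c_n\to0$, and for each $n$ let $\theta_{01},\dots,\theta_{0n}\in\mathbb R^k$ (which may depend on $n$) be sparse in the nearly-black sense: $\#\{i\le n:\theta_{0i}\ne0\}\le q_n$ with $q_n=o(n)$. Let $X_1,\dots,X_n$ be independent with $X_i\sim N_k(\theta_{0i},\Sigma)$, and let $\widehat C_i^{EIG}$ be the credible set above computed from $X_i$ with $c=c_n$. Then the posterior is, for every $n$ and every value of the observation, a probability measure with finite mean for which $\Pi(\|\theta-\widehat\theta^{EIG}\|_\Sigma^2\le\widehat r(\alpha,c_n)\mid X)=1-\alpha$; and for almost all $i$ the credible set covers the true mean with asymptotic probability at least $1-\alpha$, in the following sense: there are exceptional sets $B_n\subseteq\{1,\dots,n\}$ with $|B_n|=o(n)$ such that, for all sufficiently large $n$ and all $i\in\{1,\dots,n\}\setminus B_n$, $$P_{\theta_{0i}}\bigl(\theta_{0i}\in\widehat C_i^{EIG}\bigr)\ge1-\alpha .$$ -/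

import Mathlib

open MeasureTheory ProbabilityTheory Filter Topology Asymptotics
open scoped ENNReal Matrix MatrixOrder

namespace EIG

/-- `ℝ^k`, with its Borel structure. -/
abbrev Vec (k : ℕ) : Type := EuclideanSpace ℝ (Fin k)

/-- The squared Mahalanobis norm `‖x‖_Σ² = xᵀ Σ⁻¹ x`. -/
noncomputable def mahalanobisSq {k : ℕ} (S : Matrix (Fin k) (Fin k) ℝ) (x : Vec k) : ℝ :=
  x.ofLp ⬝ᵥ (S⁻¹ *ᵥ x.ofLp)

/-- The density at `x` of the normal distribution `N_k(θ, Σ)`, for positive definite `Σ`. -/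
noncomputable def gaussianDensity {k : ℕ} (S : Matrix (Fin k) (Fin k) ℝ) (θ x : Vec k) : ℝ :=
  (Real.sqrt ((2 * Real.pi) ^ k * S.det))⁻¹ * Real.exp (-(mahalanobisSq S (x - θ)) / 2)

/-- The density `b^d / Γ(d) · t^(-d-1) · exp (-b / t)` on `t > 0` of the inverse gamma
distribution with shape `d` and scale `b`. -/
noncomputable def invGammaDensity (d b t : ℝ) : ℝ :=
  if 0 < t then b ^ d / Real.Gamma d * t ^ (-d - 1) * Real.exp (-b / t) else 0

/-- The inverse gamma distribution with shape `d` and scale `b`. -/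
noncomputable def invGammaMeasure (d b : ℝ) : Measure ℝ :=
  volume.withDensity fun t => ENNReal.ofReal (invGammaDensity d b t)

/-- The joint prior law of the local scales `(λ², τ)`: they are independent, `λ²` has density
proportional to `exp (-λ² / 2)` and `τ` has density proportional to
`exp (-c / (2 τ)) τ^(-d-1)` on the positive half-line. -/
noncomputable def scalePrior (d c : ℝ) : Measure (ℝ × ℝ) :=
  (expMeasure (1 / 2)).prod (invGammaMeasure d (c / 2))

/-- The conditional law of `θ` given the scales depends measurably on them, so that the mixture
defining `prior` is a genuine one. -/
theorem measurable_conditionalPrior {k : ℕ} {S : Matrix (Fin k) (Fin k) ℝ} (hk : 0 < k)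
    (hS : S.PosDef) :
    Measurable fun p : ℝ × ℝ =>
      (multivariateGaussian 0 ((p.1 * p.2) • S) : Measure (Vec k)) := by
  have hm : Measurable fun t : ℝ => (multivariateGaussian 0 (t • S) : Measure (Vec k)) := by
    have h1 : (fun t : ℝ => (multivariateGaussian 0 (t • S) : Measure (Vec k))) = fun t =>
        (stdGaussian (Vec k)).map fun x =>
          Real.sqrt t • Matrix.toEuclideanCLM (𝕜 := ℝ) (CFC.sqrt S) x := by
      funext t
      rcases le_or_gt 0 t with ht | ht
      · have h2 : CFC.sqrt (t • S) = Real.sqrt t • CFC.sqrt S := by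
          refine CFC.sqrt_unique ?_ (smul_nonneg (Real.sqrt_nonneg t) (CFC.sqrt_nonneg S))
          rw [smul_mul_smul_comm, CFC.sqrt_mul_sqrt_self S hS.posSemidef.nonneg,
            Real.mul_self_sqrt ht]
        simp [multivariateGaussian, h2]
      · have h3 : ¬ (t • S).PosSemidef := by
          intro h
          have : Nonempty (Fin k) := ⟨⟨0, hk⟩⟩
          have h4 := h.trace_nonneg
          have h5 := hS.trace_pos
          rw [Matrix.trace_smul, smul_eq_mul] at h4
          nlinarith
        rw [multivariateGaussian_of_not_posSemidef _ h3, Real.sqrt_eq_zero_of_nonpos ht.le]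
        simp
    rw [h1]
    refine Measure.measurable_of_measurable_coe _ fun s hs => ?_
    have h6 : Measurable fun z : ℝ × Vec k =>
        Real.sqrt z.1 • Matrix.toEuclideanCLM (𝕜 := ℝ) (CFC.sqrt S) z.2 := by fun_prop
    have h7 := measurable_measure_prodMk_left (ν := stdGaussian (Vec k)) (h6 hs)
    convert h7 using 2 with t
    rw [Measure.map_apply (by fun_prop) hs]
    rfl
  exact hm.comp (measurable_fst.mul measurable_snd)

/-- The Exponential-Inverse-Gamma prior law of a mean vector `θ`: given `(λ², τ)`, `θ` has law
`N_k(0, λ² τ Σ)`, and `(λ², τ)` has law `scalePrior d c`. -/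
noncomputable def prior {k : ℕ} (S : Matrix (Fin k) (Fin k) ℝ) (d c : ℝ) : Measure (Vec k) :=
  (scalePrior d c).bind fun p => multivariateGaussian 0 ((p.1 * p.2) • S)

/-- The marginal density of an observation at `x` when `X | θ ~ N_k(θ, Σ)` and `θ ~ prior`. -/
noncomputable def evidence {k : ℕ} (S : Matrix (Fin k) (Fin k) ℝ) (d c : ℝ) (x : Vec k) : ℝ≥0∞ :=
  ∫⁻ θ, ENNReal.ofReal (gaussianDensity S θ x) ∂(prior S d c)

/-- The posterior law `Π(θ ∈ · | X = x)`, by Bayes' formula. -/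
noncomputable def posterior {k : ℕ} (S : Matrix (Fin k) (Fin k) ℝ) (d c : ℝ) (x : Vec k) :
    Measure (Vec k) :=
  (evidence S d c x)⁻¹ •
    (prior S d c).withDensity fun θ => ENNReal.ofReal (gaussianDensity S θ x)

/-- The posterior mean `θ̂ = E(θ | X = x)`. -/
noncomputable def posteriorMean {k : ℕ} (S : Matrix (Fin k) (Fin k) ℝ) (d c : ℝ) (x : Vec k) :
    Vec k :=
  ∫ θ, θ ∂(posterior S d c x)

/-- The posterior probability `Π(‖θ - θ̂‖_Σ² ≤ r | X = x)`. -/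
noncomputable def posteriorBallProb {k : ℕ} (S : Matrix (Fin k) (Fin k) ℝ) (d c : ℝ) (x : Vec k)
    (r : ℝ) : ℝ :=
  (posterior S d c x).real {θ | mahalanobisSq S (θ - posteriorMean S d c x) ≤ r}

/-- The radius `r̂(α, c)` at `X = x`: the `(1 - α)`-quantile of `‖θ - θ̂‖_Σ²` under the posterior.
(The main theorem asserts that it solves `Π(‖θ - θ̂‖_Σ² ≤ r̂ | X = x) = 1 - α`.) -/
noncomputable def radius {k : ℕ} (S : Matrix (Fin k) (Fin k) ℝ) (d c α : ℝ) (x : Vec k) : ℝ :=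
  sInf {r : ℝ | 1 - α ≤ posteriorBallProb S d c x r}

/-- The credible set `Ĉ = {θ : ‖θ - θ̂‖_Σ² ≤ L r̂(α, c)^(d/(1+ρ))}` at `X = x`. -/
noncomputable def credibleSet {k : ℕ} (S : Matrix (Fin k) (Fin k) ℝ) (d c α ρ L : ℝ)
    (x : Vec k) : Set (Vec k) :=
  {θ | mahalanobisSq S (θ - posteriorMean S d c x) ≤ L * radius S d c α x ^ (d / (1 + ρ))}

/-- The upper `α`-quantile `χ²_{k,α}` of the chi-square distribution with `k` degrees of freedom
(the gamma distribution of shape `k/2` and rate `1/2`), so that `P(χ²_k > χ²_{k,α}) = α`. -/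
noncomputable def chiSqUpperQuantile (k : ℕ) (α : ℝ) : ℝ :=
  sInf {t : ℝ | 1 - α ≤ (gammaMeasure ((k : ℝ) / 2) (1 / 2)).real (Set.Iic t)}

/-- The set `L₀[q]` of families of `n` mean vectors in `ℝ^k` at most `q` of which are nonzero. -/
def nearlyBlack (k n : ℕ) (q : ℝ) : Set (Fin n → Vec k) :=
  {θ | ((Finset.univ.filter fun i => θ i ≠ 0).card : ℝ) ≤ q}

/-- The joint law of independent observations `X_i ~ N_k(θ_i, Σ)`, `i = 1, …, n`. -/
noncomputable def dataLaw {k n : ℕ} (S : Matrix (Fin k) (Fin k) ℝ) (θ : Fin n → Vec k) :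
    Measure (Fin n → Vec k) :=
  Measure.pi fun i => multivariateGaussian (θ i) S

/-- The coverage probability `P_{θ₀}(θ₀ᵢ ∈ Ĉᵢ)`, where `Ĉᵢ` is computed from `Xᵢ`. -/
noncomputable def coverage {k n : ℕ} (S : Matrix (Fin k) (Fin k) ℝ) (d c α ρ L : ℝ)
    (θ₀ : Fin n → Vec k) (i : Fin n) : ℝ :=
  (dataLaw S θ₀).real {X | θ₀ i ∈ credibleSet S d c α ρ L (X i)}

end EIG

namespace EIG

/-! ### Absolute continuity of Gaussian measures -/

/-! The exceptional indices are the nonzero means, at most `q n = o(n)` of them, so only coverage of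
the mean `0` is at stake. Fix `M` such that `N_k(0, Σ)` gives the ball of radius `M` mass above `1 -
α`. It suffices that, for small `c`, the credible set contains `0` for every observation `x` with
`‖x‖ ≤ M`.

Everything rests on scaling: the prior with parameter `c` is the image of the prior with parameter
`1` under `θ ↦ √c θ` (`prior_eq_map`). For `‖x‖ ≤ M` and `c ≤ 1` this gives two bounds uniform in
`x`. The prior has a finite moment of order `d`, of size `c^(d/2)`, and the likelihood trades `‖θ‖`
for `‖θ‖^d`, so the posterior mean is `O(c^(d/2))` (`exists_norm_posteriorMean_le`). The posterior
is at most a constant times the prior, which spreads at scale `√c`, so the squared radius is at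
least `ε c` (`exists_le_radius`). Thus the squared distance from `0` to the centre is `O(c^d)`,
while the threshold is at least of order `c^(d/(1+ρ))`, which is larger for small `c`
(`eventually_zero_mem_credibleSet`). -/

theorem pi_fin_absolutelyContinuous {n : ℕ} {α : Type*} [MeasurableSpace α]
    {μ ν : Measure α} [SigmaFinite μ] [SigmaFinite ν] (h : μ ≪ ν) :
    Measure.pi (fun _ : Fin n => μ) ≪ Measure.pi (fun _ : Fin n => ν) := by
  induction n with
  | zero =>
    rw [Measure.pi_of_empty, Measure.pi_of_empty]
  | succ n ih =>
    have hμ := measurePreserving_piFinSuccAbove (fun _ : Fin (n + 1) => μ) 0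
    have hν := measurePreserving_piFinSuccAbove (fun _ : Fin (n + 1) => ν) 0
    rw [← hμ.symm.map_eq, ← hν.symm.map_eq]
    exact (h.prod ih).map (MeasurableEquiv.measurable _)

theorem stdGaussian_absolutelyContinuous (k : ℕ) :
    stdGaussian (Vec k) ≪ (volume : Measure (Vec k)) := by
  rw [← map_pi_eq_stdGaussian, ← (PiLp.volume_preserving_toLp (Fin k)).map_eq, volume_pi]
  exact (pi_fin_absolutelyContinuous (gaussianReal_absolutelyContinuous 0 one_ne_zero)).map
    (by fun_prop)

theorem volume_preimage_eq_zero {k : ℕ} {B : Vec k →L[ℝ] Vec k} (hB : IsUnit B) {s : Set (Vec k)}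
    (hs : volume s = 0) : volume (B ⁻¹' s) = 0 := by
  have h : LinearMap.det (B : Vec k →ₗ[ℝ] Vec k) ≠ 0 := by
    have h1 : IsUnit (B : Vec k →ₗ[ℝ] Vec k) :=
      hB.map (ContinuousLinearMap.toLinearMapRingHom (R₁ := ℝ) (M₁ := Vec k))
    exact (h1.map LinearMap.det).ne_zero
  have h2 := Measure.addHaar_preimage_continuousLinearMap (volume : Measure (Vec k)) h s
  rw [h2, hs, mul_zero]

theorem isUnit_toEuclideanCLM_sqrt {k : ℕ} {S : Matrix (Fin k) (Fin k) ℝ} (hS : S.PosDef) :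
    IsUnit (Matrix.toEuclideanCLM (𝕜 := ℝ) (CFC.sqrt S)) :=
  ((CFC.isUnit_sqrt_iff S hS.posSemidef.nonneg).2 hS.isUnit).map
    (Matrix.toEuclideanCLM (n := Fin k) (𝕜 := ℝ))

theorem multivariateGaussian_absolutelyContinuous {k : ℕ} {S : Matrix (Fin k) (Fin k) ℝ}
    (hS : S.PosDef) : (multivariateGaussian 0 S : Measure (Vec k)) ≪ volume := by
  refine Measure.AbsolutelyContinuous.mk fun s hs h0 => ?_
  rw [multivariateGaussian, Measure.map_apply (by fun_prop) hs]
  refine stdGaussian_absolutelyContinuous k ?_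
  simpa using volume_preimage_eq_zero (isUnit_toEuclideanCLM_sqrt hS) h0

theorem multivariateGaussian_smul {k : ℕ} {S : Matrix (Fin k) (Fin k) ℝ} (hk : 0 < k)
    (hS : S.PosDef) (t : ℝ) :
    (multivariateGaussian 0 (t • S) : Measure (Vec k)) = (stdGaussian (Vec k)).map fun x =>
      Real.sqrt t • Matrix.toEuclideanCLM (𝕜 := ℝ) (CFC.sqrt S) x := by
  rcases le_or_gt 0 t with ht | ht
  · have h2 : CFC.sqrt (t • S) = Real.sqrt t • CFC.sqrt S := by
      refine CFC.sqrt_unique ?_ (smul_nonneg (Real.sqrt_nonneg t) (CFC.sqrt_nonneg S))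
      rw [smul_mul_smul_comm, CFC.sqrt_mul_sqrt_self S hS.posSemidef.nonneg,
        Real.mul_self_sqrt ht]
    simp [multivariateGaussian, h2]
  -- For negative `t` both sides are the Dirac mass at `0`: the Gaussian by its default value, the
  -- image because `Real.sqrt t = 0`.
  · have h3 : ¬ (t • S).PosSemidef := by
      intro h
      have : Nonempty (Fin k) := ⟨⟨0, hk⟩⟩
      have h4 := h.trace_nonneg
      have h5 := hS.trace_pos
      rw [Matrix.trace_smul, smul_eq_mul] at h4
      nlinarith
    rw [multivariateGaussian_of_not_posSemidef _ h3, Real.sqrt_eq_zero_of_nonpos ht.le]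
    simp

/-! ### The Mahalanobis norm -/

/-- Take `B` to be the symmetric square root of `Σ⁻¹`; this transfers questions to the Euclidean
norm. -/
theorem exists_mahalanobisSq_eq {k : ℕ} {S : Matrix (Fin k) (Fin k) ℝ} (hS : S.PosDef) :
    ∃ B : Vec k →L[ℝ] Vec k, IsUnit B ∧ ∀ x, mahalanobisSq S x = ‖B x‖ ^ 2 := by
  have hS' : S⁻¹.PosDef := hS.inv
  refine ⟨Matrix.toEuclideanCLM (𝕜 := ℝ) (CFC.sqrt S⁻¹), isUnit_toEuclideanCLM_sqrt hS', fun x => ?_⟩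
  have h : (CFC.sqrt S⁻¹)ᵀ = CFC.sqrt S⁻¹ := by
    have := (CFC.sqrt_nonneg S⁻¹).isSelfAdjoint.star_eq
    rwa [Matrix.star_eq_conjTranspose, Matrix.conjTranspose_eq_transpose_of_trivial] at this
  rw [EuclideanSpace.real_norm_sq_eq, mahalanobisSq]
  conv_lhs => rw [← CFC.sqrt_mul_sqrt_self S⁻¹ hS'.posSemidef.nonneg]
  rw [← Matrix.mulVec_mulVec, Matrix.dotProduct_mulVec, ← Matrix.mulVec_transpose, h]
  simp [dotProduct, sq]

theorem measurable_mahalanobisSq {k : ℕ} {S : Matrix (Fin k) (Fin k) ℝ} (hS : S.PosDef) :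
    Measurable (mahalanobisSq S) := by
  obtain ⟨B, -, h⟩ := exists_mahalanobisSq_eq hS
  rw [funext h]
  fun_prop

theorem mahalanobisSq_nonneg {k : ℕ} {S : Matrix (Fin k) (Fin k) ℝ} (hS : S.PosDef) (x : Vec k) :
    0 ≤ mahalanobisSq S x := by
  obtain ⟨B, -, h⟩ := exists_mahalanobisSq_eq hS
  rw [h]
  positivity

theorem mahalanobisSq_smul {k : ℕ} (S : Matrix (Fin k) (Fin k) ℝ) (t : ℝ) (x : Vec k) :
    mahalanobisSq S (t • x) = t ^ 2 * mahalanobisSq S x := by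
  simp [mahalanobisSq, Matrix.mulVec_smul]
  ring

theorem exists_mahalanobisSq_bounds {k : ℕ} {S : Matrix (Fin k) (Fin k) ℝ} (hS : S.PosDef) :
    ∃ K : ℝ, 0 < K ∧ ∀ x, mahalanobisSq S x ≤ K * ‖x‖ ^ 2 ∧ ‖x‖ ^ 2 ≤ K * mahalanobisSq S x := by
  obtain ⟨B, ⟨u, rfl⟩, h⟩ := exists_mahalanobisSq_eq hS
  set B : Vec k →L[ℝ] Vec k := (u : Vec k →L[ℝ] Vec k)
  set B' : Vec k →L[ℝ] Vec k := (↑u⁻¹ : Vec k →L[ℝ] Vec k)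
  refine ⟨‖B‖ ^ 2 + ‖B'‖ ^ 2 + 1, by positivity, fun x => ?_⟩
  rw [h]
  constructor
  · calc ‖B x‖ ^ 2 ≤ (‖B‖ * ‖x‖) ^ 2 := by gcongr; exact B.le_opNorm x
      _ ≤ _ := by rw [mul_pow]; gcongr; nlinarith [sq_nonneg ‖B'‖]
  · have h1 : B' (B x) = x := by
      rw [← mul_apply_eq_comp, Units.inv_mul, one_apply_eq_self]
    calc ‖x‖ ^ 2 = ‖B' (B x)‖ ^ 2 := by rw [h1]
      _ ≤ (‖B'‖ * ‖B x‖) ^ 2 := by gcongr; exact B'.le_opNorm _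
      _ ≤ _ := by rw [mul_pow]; gcongr; nlinarith [sq_nonneg ‖B‖]

theorem volume_mahalanobisSq_sub_eq {k : ℕ} {S : Matrix (Fin k) (Fin k) ℝ} (hk : 0 < k)
    (hS : S.PosDef) (a : Vec k) (r : ℝ) :
    volume {θ : Vec k | mahalanobisSq S (θ - a) = r} = 0 := by
  obtain ⟨B, hB, h⟩ := exists_mahalanobisSq_eq hS
  -- In dimension zero the sphere of radius `0` would be the whole space and not null.
  have : Nonempty (Fin k) := ⟨⟨0, hk⟩⟩
  refine measure_mono_null ?_ (volume_preimage_eq_zero hB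
    (Measure.addHaar_sphere volume (B a) (Real.sqrt r)))
  intro θ hθ
  rw [Set.mem_ofPred_eq, h, map_sub] at hθ
  rw [Set.mem_preimage, mem_sphere_iff_norm, ← hθ, Real.sqrt_sq (norm_nonneg _)]


/-! ### The inverse gamma distribution -/

/-- Substituting `t = b / g` exhibits `b` as a scale parameter and turns moments into negative
moments of a gamma law. -/
theorem invGammaMeasure_eq_map {d b : ℝ} (hb : 0 < b) :
    invGammaMeasure d b = (gammaMeasure d 1).map fun g => b / g := by
  have hm : Measurable fun g : ℝ => b / g := by fun_prop
  ext s hs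
  rw [Measure.map_apply hm hs, invGammaMeasure, gammaMeasure, withDensity_apply _ hs,
    withDensity_apply _ (hm hs)]
  have h1 : ∫⁻ t in s, ENNReal.ofReal (invGammaDensity d b t) =
      ∫⁻ t in s ∩ Set.Ioi 0, ENNReal.ofReal (invGammaDensity d b t) := by
    rw [← lintegral_indicator hs, ← lintegral_indicator (hs.inter measurableSet_Ioi)]
    refine lintegral_congr fun t => ?_
    by_cases h0 : 0 < t
    · by_cases hts : t ∈ s
      · rw [Set.indicator_of_mem hts,
          Set.indicator_of_mem (Set.mem_inter hts (show t ∈ Set.Ioi 0 from h0))]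
      · rw [Set.indicator_of_notMem hts, Set.indicator_of_notMem fun h => hts h.1]
    · simp [Set.indicator, h0, invGammaDensity]
  -- `gammaPDF` need not vanish at `0`, so this equality uses that a point is null.
  have h2 : ∫⁻ g in (fun g => b / g) ⁻¹' s, gammaPDF d 1 g =
      ∫⁻ g in ((fun g => b / g) ⁻¹' s) ∩ Set.Ioi 0, gammaPDF d 1 g := by
    rw [← lintegral_indicator (hm hs), ← lintegral_indicator ((hm hs).inter measurableSet_Ioi)]
    refine lintegral_congr_ae ?_
    filter_upwards [compl_mem_ae_iff.2 (measure_singleton (0 : ℝ))] with g hg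
    rcases lt_or_gt_of_ne (show g ≠ 0 from hg) with h0 | h0
    · simp [Set.indicator, h0.not_gt, gammaPDF_of_neg h0]
    · by_cases hts : g ∈ (fun g => b / g) ⁻¹' s
      · rw [Set.indicator_of_mem hts,
          Set.indicator_of_mem (Set.mem_inter hts (show g ∈ Set.Ioi 0 from h0))]
      · rw [Set.indicator_of_notMem hts, Set.indicator_of_notMem fun h => hts h.1]
  have himg : s ∩ Set.Ioi 0 = (fun g => b / g) '' (((fun g => b / g) ⁻¹' s) ∩ Set.Ioi 0) := by
    ext t
    constructor
    · rintro ⟨h, h0⟩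
      have h0' : (0 : ℝ) < t := h0
      have hbt : b / (b / t) = t := by field_simp
      exact ⟨b / t, ⟨by simpa [hbt] using h, div_pos hb h0⟩, hbt⟩
    · rintro ⟨g, ⟨h, h0⟩, rfl⟩
      exact ⟨h, div_pos hb h0⟩
  rw [h1, h2, himg, lintegral_image_eq_lintegral_abs_deriv_mul
    ((hm hs).inter measurableSet_Ioi) (f' := fun g => -b / g ^ 2)]
  · refine setLIntegral_congr_fun ((hm hs).inter measurableSet_Ioi) fun g hg => ?_
    have h0 : 0 < g := hg.2
    have h3 : 0 < b / g := div_pos hb h0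
    rw [gammaPDF_of_nonneg h0.le, ← ENNReal.ofReal_mul (abs_nonneg _), invGammaDensity, if_pos h3,
      abs_div, abs_neg, abs_of_pos hb, abs_of_pos (by positivity : 0 < g ^ 2)]
    congr 1
    have h4 : -b / (b / g) = -(1 * g) := by field_simp
    have h5 : (b / g) ^ (-d - 1) = b ^ (-d) * b⁻¹ * (g ^ (d - 1) * g ^ 2) := by
      rw [Real.div_rpow hb.le h0.le, Real.rpow_sub_one hb.ne', div_eq_mul_inv, div_eq_mul_inv,
        ← Real.rpow_neg h0.le, ← Real.rpow_natCast g 2, ← Real.rpow_add h0]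
      congr 2
      push_cast
      ring
    rw [h4, h5, Real.rpow_neg hb.le, Real.one_rpow]
    have := Real.rpow_pos_of_pos hb d
    field_simp
  · intro g hg
    have h0 : g ≠ 0 := ne_of_gt hg.2
    have h := ((hasDerivAt_inv h0).const_mul b).hasDerivWithinAt
      (s := ((fun g => b / g) ⁻¹' s) ∩ Set.Ioi 0)
    have e1 : -b / g ^ 2 = b * -(g ^ 2)⁻¹ := by ring
    have e2 : (fun g => b / g) = fun g => b * g⁻¹ := funext fun g => div_eq_mul_inv b g
    simp only [e1]
    rwa [e2] at h ⊢
  · intro g hg g' hg' h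
    have h0 : 0 < g := hg.2
    have h0' : 0 < g' := hg'.2
    dsimp only at h
    rw [div_eq_div_iff h0.ne' h0'.ne'] at h
    exact (mul_left_cancel₀ hb.ne' h).symm

theorem isProbabilityMeasure_invGammaMeasure {d b : ℝ} (hd : 0 < d) (hb : 0 < b) :
    IsProbabilityMeasure (invGammaMeasure d b) := by
  have := isProbabilityMeasure_gammaMeasure hd one_pos
  rw [invGammaMeasure_eq_map hb]
  exact Measure.isProbabilityMeasure_map (by fun_prop)

/-- The condition `0 < a + s` is integrability of `x^(a+s-1)` at `0`; the exponential settles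
infinity. -/
theorem lintegral_rpow_gammaMeasure_lt_top {a r s : ℝ} (hr : 0 < r) (hs : 0 < a + s) :
    ∫⁻ x, ENNReal.ofReal (|x| ^ s) ∂(gammaMeasure a r) < ∞ := by
  have hm : Measurable (gammaPDF a r) := (measurable_gammaPDFReal a r).ennreal_ofReal
  rw [gammaMeasure, lintegral_withDensity_eq_lintegral_mul _ hm (by fun_prop)]
  have h1 : IntegrableOn (fun x : ℝ => r ^ a / Real.Gamma a *
      (x ^ (a + s - 1) * Real.exp (-r * x ^ (1 : ℝ)))) (Set.Ioi 0) :=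
    (integrableOn_rpow_mul_exp_neg_mul_rpow (by linarith) one_pos hr).const_mul _
  rw [← integrable_indicator_iff measurableSet_Ioi] at h1
  refine lt_of_eq_of_lt (lintegral_congr_ae ?_) h1.lintegral_lt_top
  filter_upwards [compl_mem_ae_iff.2 (measure_singleton (0 : ℝ))] with x hx
  rcases lt_or_gt_of_ne (show x ≠ 0 from hx) with h0 | h0
  · simp [Set.indicator, h0.not_gt, gammaPDF_of_neg h0]
  · have h2 : 0 ≤ |x| ^ s := by positivity
    rw [Pi.mul_apply, gammaPDF_of_nonneg h0.le, ← ENNReal.ofReal_mul' h2,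
      Set.indicator_of_mem (show x ∈ Set.Ioi 0 from h0), abs_of_pos h0, Real.rpow_one,
      show a + s - 1 = (a - 1) + s by ring, Real.rpow_add h0]
    congr 1
    rw [neg_mul]
    ring

/-! ### The prior -/

theorem isProbabilityMeasure_scalePrior {d c : ℝ} (hd : 0 < d) (hc : 0 < c) :
    IsProbabilityMeasure (scalePrior d c) := by
  have := isProbabilityMeasure_invGammaMeasure hd (half_pos hc)
  have := isProbabilityMeasure_expMeasure (r := 1 / 2) (by norm_num)
  unfold scalePrior
  infer_instance

theorem isProbabilityMeasure_prior {k : ℕ} {S : Matrix (Fin k) (Fin k) ℝ} (hk : 0 < k)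
    (hS : S.PosDef) {d c : ℝ} (hd : 0 < d) (hc : 0 < c) :
    IsProbabilityMeasure (prior S d c) := by
  have := isProbabilityMeasure_scalePrior hd hc
  refine ⟨?_⟩
  rw [prior, Measure.bind_apply .univ (measurable_conditionalPrior hk hS).aemeasurable]
  simp

theorem scalePrior_eq_map {d c : ℝ} (hd : 0 < d) (hc : 0 < c) :
    scalePrior d c = (scalePrior d 1).map fun p => (p.1, c * p.2) := by
  have := isProbabilityMeasure_invGammaMeasure hd (half_pos one_pos)
  have := isProbabilityMeasure_expMeasure (r := 1 / 2) (by norm_num)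
  have h : invGammaMeasure d (c / 2) = (invGammaMeasure d (1 / 2)).map fun t => c * t := by
    rw [invGammaMeasure_eq_map (half_pos hc), invGammaMeasure_eq_map (half_pos one_pos),
      Measure.map_map (by fun_prop) (by fun_prop)]
    congr 1
    ext g
    simp only [Function.comp_apply]
    ring
  rw [scalePrior, h, scalePrior]
  have := Measure.map_prod_map (expMeasure (1 / 2)) (invGammaMeasure d (1 / 2))
    measurable_id (measurable_const_mul c)
  rw [Measure.map_id] at this
  exact this

/-- Represents `θ` as `√(λ²τ) Σ^(1/2) Z` with `Z` standard normal, independent of the scales. -/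
theorem lintegral_prior {k : ℕ} {S : Matrix (Fin k) (Fin k) ℝ} (hk : 0 < k)
    (hS : S.PosDef) {d c : ℝ} {f : Vec k → ℝ≥0∞} (hf : Measurable f) :
    ∫⁻ θ, f θ ∂(prior S d c) = ∫⁻ p, ∫⁻ x,
      f (Real.sqrt (p.1 * p.2) • Matrix.toEuclideanCLM (𝕜 := ℝ) (CFC.sqrt S) x)
      ∂(stdGaussian (Vec k)) ∂(scalePrior d c) := by
  rw [prior, Measure.lintegral_bind (measurable_conditionalPrior hk hS).aemeasurable
    hf.aemeasurable]
  refine lintegral_congr fun p => ?_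
  rw [multivariateGaussian_smul hk hS, lintegral_map hf (by fun_prop)]

theorem prior_eq_map {k : ℕ} {S : Matrix (Fin k) (Fin k) ℝ} (hk : 0 < k)
    (hS : S.PosDef) {d c : ℝ} (hd : 0 < d) (hc : 0 < c) :
    prior S d c = (prior S d 1).map fun θ => Real.sqrt c • θ := by
  refine Measure.ext_of_lintegral _ fun f hf => ?_
  have hg : Measurable fun z : (ℝ × ℝ) × Vec k =>
      f (Real.sqrt (z.1.1 * z.1.2) • Matrix.toEuclideanCLM (𝕜 := ℝ) (CFC.sqrt S) z.2) := by
    fun_prop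
  rw [lintegral_map hf (by fun_prop), lintegral_prior hk hS hf, scalePrior_eq_map hd hc,
    lintegral_map hg.lintegral_prod_right' (by fun_prop),
    lintegral_prior hk hS (f := fun θ => f (Real.sqrt c • θ)) (by fun_prop)]
  refine lintegral_congr fun p => lintegral_congr fun x => ?_
  dsimp only
  rw [smul_smul, ← Real.sqrt_mul hc.le]
  rw [mul_left_comm]

/-- Almost surely `λ²τ > 0`, so the prior is a mixture of nondegenerate Gaussians. -/
theorem prior_absolutelyContinuous {k : ℕ} {S : Matrix (Fin k) (Fin k) ℝ} (hk : 0 < k)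
    (hS : S.PosDef) {d c : ℝ} (hd : 0 < d) (hc : 0 < c) : prior S d c ≪ volume := by
  refine Measure.AbsolutelyContinuous.mk fun s hs h0 => ?_
  have := isProbabilityMeasure_invGammaMeasure hd (half_pos hc)
  have := isProbabilityMeasure_expMeasure (r := 1 / 2) (by norm_num)
  rw [prior, Measure.bind_apply hs (measurable_conditionalPrior hk hS).aemeasurable,
    lintegral_eq_zero_iff' (by
      exact ((Measure.measurable_coe hs).comp (measurable_conditionalPrior hk hS)).aemeasurable)]
  have h1 : ∀ᵐ t ∂(expMeasure (1 / 2)), 0 < t := by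
    have hm : Measurable (gammaPDF 1 (1 / 2)) := (measurable_gammaPDFReal _ _).ennreal_ofReal
    rw [expMeasure, gammaMeasure, ae_withDensity_iff hm]
    filter_upwards [compl_mem_ae_iff.2 (measure_singleton (0 : ℝ))] with x hx h
    by_contra h'
    exact h (gammaPDF_of_neg (lt_of_le_of_ne (not_lt.1 h') hx))
  have h2 : ∀ᵐ t ∂(invGammaMeasure d (c / 2)), 0 < t := by
    rw [invGammaMeasure, ae_withDensity_iff (by
      unfold invGammaDensity
      refine Measurable.ennreal_ofReal (Measurable.ite measurableSet_Ioi ?_ measurable_const)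
      fun_prop)]
    refine ae_of_all _ fun x h => ?_
    by_contra h'
    exact h (by simp [invGammaDensity, h'])
  have h3 : ∀ᵐ p ∂(scalePrior d c), 0 < p.1 * p.2 := by
    have h4 : ∀ᵐ p ∂(scalePrior d c), 0 < p.1 :=
      Measure.quasiMeasurePreserving_fst.ae h1
    have h5 : ∀ᵐ p ∂(scalePrior d c), 0 < p.2 :=
      Measure.quasiMeasurePreserving_snd.ae h2
    filter_upwards [h4, h5] with p hp hp' using mul_pos hp hp'
  filter_upwards [h3] with p hp
  exact multivariateGaussian_absolutelyContinuous (hS.smul hp) h0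

/-- The moment factors over `λ²`, `τ` and `Z`. The factor `E τ^(d/2)` is finite because `d/2` is
below the shape `d`; a first moment of `θ` would need `E τ^(1/2)`, infinite when `d ≤ 1/2`. -/
theorem lintegral_norm_rpow_prior_lt_top {k : ℕ} {S : Matrix (Fin k) (Fin k) ℝ} (hk : 0 < k)
    (hS : S.PosDef) {d : ℝ} (hd0 : 0 < d) (hd1 : d ≤ 1) :
    ∫⁻ θ, ENNReal.ofReal (‖θ‖ ^ d) ∂(prior S d 1) < ∞ := by
  have := isProbabilityMeasure_invGammaMeasure hd0 (half_pos one_pos)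
  have := isProbabilityMeasure_expMeasure (r := 1 / 2) (by norm_num)
  set A := Matrix.toEuclideanCLM (𝕜 := ℝ) (CFC.sqrt S)
  have hA : ∫⁻ x, ENNReal.ofReal (‖A x‖ ^ d) ∂(stdGaussian (Vec k)) < ∞ := by
    have hi : Integrable (fun x => 1 + ‖A x‖) (stdGaussian (Vec k)) :=
      (integrable_const _).add (A.integrable_comp IsGaussian.integrable_id).norm
    refine lt_of_le_of_lt (lintegral_mono fun x => ENNReal.ofReal_le_ofReal ?_)
      hi.lintegral_lt_top
    rcases le_total ‖A x‖ 1 with h | h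
    · exact (Real.rpow_le_one (norm_nonneg _) h hd0.le).trans (by simp)
    · exact (Real.rpow_le_rpow_of_exponent_le h hd1).trans (by simp)
  have hE : ∫⁻ t, ENNReal.ofReal (|t| ^ (d / 2)) ∂(expMeasure (1 / 2)) < ∞ :=
    lintegral_rpow_gammaMeasure_lt_top (by norm_num) (by positivity)
  have hI : ∫⁻ t, ENNReal.ofReal (|t| ^ (d / 2)) ∂(invGammaMeasure d (1 / 2)) < ∞ := by
    rw [invGammaMeasure_eq_map (half_pos one_pos), lintegral_map (by fun_prop) (by fun_prop)]
    have h : ∀ g : ℝ, ENNReal.ofReal (|1 / 2 / g| ^ (d / 2)) =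
        ENNReal.ofReal ((1 / 2) ^ (d / 2)) * ENNReal.ofReal (|g| ^ (-(d / 2))) := fun g => by
      rw [← ENNReal.ofReal_mul (by positivity), abs_div, Real.div_rpow (by positivity)
        (by positivity), Real.rpow_neg (by positivity), div_eq_mul_inv, abs_of_pos (by norm_num)]
    simp_rw [h]
    rw [lintegral_const_mul _ (by fun_prop)]
    exact ENNReal.mul_lt_top ENNReal.ofReal_lt_top
      (lintegral_rpow_gammaMeasure_lt_top one_pos (by linarith))
  rw [lintegral_prior hk hS (by fun_prop)]
  have h : ∀ (p : ℝ × ℝ) (x : Vec k), ENNReal.ofReal (‖Real.sqrt (p.1 * p.2) • A x‖ ^ d) ≤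
      ENNReal.ofReal (|p.1| ^ (d / 2)) * ENNReal.ofReal (|p.2| ^ (d / 2)) *
        ENNReal.ofReal (‖A x‖ ^ d) := fun p x => by
    rw [← ENNReal.ofReal_mul (by positivity), ← ENNReal.ofReal_mul (by positivity),
      norm_smul, Real.mul_rpow (norm_nonneg _) (norm_nonneg _),
      ← Real.mul_rpow (abs_nonneg _) (abs_nonneg _), ← abs_mul, Real.norm_of_nonneg
      (Real.sqrt_nonneg _)]
    refine ENNReal.ofReal_le_ofReal (mul_le_mul_of_nonneg_right ?_ (by positivity))
    calc Real.sqrt (p.1 * p.2) ^ d ≤ Real.sqrt |p.1 * p.2| ^ d := by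
          gcongr; exact le_abs_self _
      _ = |p.1 * p.2| ^ (d / 2) := by
          rw [Real.sqrt_eq_rpow, ← Real.rpow_mul (abs_nonneg _)]
          congr 1
          ring
  refine lt_of_le_of_lt (lintegral_mono fun p => lintegral_mono fun x => h p x) ?_
  simp_rw [lintegral_const_mul _ (show Measurable fun x => ENNReal.ofReal (‖A x‖ ^ d) by fun_prop)]
  rw [lintegral_mul_const _ (by fun_prop), scalePrior,
    lintegral_prod_mul (f := fun t => ENNReal.ofReal (|t| ^ (d / 2)))
      (g := fun t => ENNReal.ofReal (|t| ^ (d / 2))) (by fun_prop) (by fun_prop)]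
  exact ENNReal.mul_lt_top (ENNReal.mul_lt_top hE hI) hA


/-! ### Quantiles of atomless laws -/

theorem continuous_cdf_of_nullSingletonClass (μ : Measure ℝ) [IsProbabilityMeasure μ] [NullSingletonClass μ] :
    Continuous (cdf μ) := by
  refine continuous_iff_continuousAt.2 fun a => ?_
  rw [continuousAt_iff_continuous_left'_right']
  refine ⟨?_, ((cdf μ).right_continuous a).mono Set.Ioi_subset_Ici_self⟩
  rw [(cdf μ).mono.continuousWithinAt_Iio_iff_leftLim_eq]
  have h := (cdf μ).measure_singleton a
  rw [measure_cdf, measure_singleton] at h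
  have h1 := ENNReal.ofReal_eq_zero.1 h.symm
  exact le_antisymm ((cdf μ).mono.leftLim_le le_rfl) (by linarith)

/-- By continuity the level `p` is attained, and the closed superlevel set contains its infimum. -/
theorem cdf_sInf_eq (μ : Measure ℝ) [IsProbabilityMeasure μ] [NullSingletonClass μ] {p : ℝ} (h0 : 0 < p)
    (h1 : p < 1) : cdf μ (sInf {r | p ≤ cdf μ r}) = p := by
  have hc := continuous_cdf_of_nullSingletonClass μ
  have hlt : ∃ a, cdf μ a < p := ((tendsto_cdf_atBot μ).eventually_lt_const h0).exists
  have hgt : ∃ a, p < cdf μ a := ((tendsto_cdf_atTop μ).eventually_const_lt h1).exists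
  obtain ⟨a, ha⟩ := hlt
  obtain ⟨r, hr⟩ := mem_range_of_exists_le_of_exists_ge hc ⟨a, ha.le⟩ (hgt.imp fun _ => le_of_lt)
  have hbdd : BddBelow {r | p ≤ cdf μ r} :=
    ⟨a, fun x hx => le_of_not_gt fun hxa => absurd (hx.trans (monotone_cdf μ hxa.le)) ha.not_ge⟩
  refine le_antisymm ?_ ((isClosed_le continuous_const hc).csInf_mem ⟨r, hr.ge⟩ hbdd)
  exact (monotone_cdf μ (csInf_le hbdd hr.ge)).trans hr.le

theorem measureReal_le_sInf_eq {Ω : Type*} [MeasurableSpace Ω] (ν : Measure Ω)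
    [IsProbabilityMeasure ν] {g : Ω → ℝ} (hg : Measurable g) (hν : ∀ r, ν {ω | g ω = r} = 0)
    {p : ℝ} (h0 : 0 < p) (h1 : p < 1) :
    ν.real {ω | g ω ≤ sInf {r | p ≤ ν.real {ω | g ω ≤ r}}} = p := by
  have := Measure.isProbabilityMeasure_map (μ := ν) hg.aemeasurable
  have : NullSingletonClass (ν.map g) := ⟨fun r => by
    rw [Measure.map_apply hg (measurableSet_singleton r)]
    exact hν r⟩
  have h : ∀ r, ν.real {ω | g ω ≤ r} = cdf (ν.map g) r := fun r => by
    rw [cdf_eq_real, map_measureReal_apply hg measurableSet_Iic]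
    rfl
  simp_rw [h]
  exact cdf_sInf_eq _ h0 h1

theorem exists_lt_measure_closedBall {k : ℕ} (μ : Measure (Vec k)) [IsProbabilityMeasure μ]
    {p : ℝ≥0∞} (hp : p < 1) : ∃ R : ℝ, 0 ≤ R ∧ p < μ (Metric.closedBall 0 R) := by
  have hm : Monotone fun n : ℕ => Metric.closedBall (0 : Vec k) (n : ℝ) := fun m n h =>
    Metric.closedBall_subset_closedBall (by exact_mod_cast h)
  have h := tendsto_measure_iUnion_atTop (μ := μ) hm
  rw [Metric.iUnion_closedBall_nat, measure_univ] at h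
  obtain ⟨n, hn⟩ := (h.eventually_const_lt hp).exists
  exact ⟨n, n.cast_nonneg, hn⟩

/-! ### The Gaussian density -/

section density

variable {k : ℕ} {S : Matrix (Fin k) (Fin k) ℝ}

theorem gaussianDensity_pos (hS : S.PosDef) (θ x : Vec k) : 0 < gaussianDensity S θ x := by
  have := hS.det_pos
  unfold gaussianDensity
  positivity

theorem measurable_gaussianDensity (hS : S.PosDef) (x : Vec k) :
    Measurable fun θ => ENNReal.ofReal (gaussianDensity S θ x) := by
  have := measurable_mahalanobisSq hS
  unfold gaussianDensity
  fun_prop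

theorem gaussianDensity_le (hS : S.PosDef) (θ x : Vec k) :
    gaussianDensity S θ x ≤ (Real.sqrt ((2 * Real.pi) ^ k * S.det))⁻¹ := by
  have := hS.det_pos
  refine mul_le_of_le_one_right (by positivity) (Real.exp_le_one_iff.2 ?_)
  have := mahalanobisSq_nonneg hS (x - θ)
  linarith

theorem exists_gaussianDensity_ge (hS : S.PosDef) (M : ℝ) :
    ∃ δ : ℝ, 0 < δ ∧ ∀ θ x : Vec k, ‖θ‖ ≤ M → ‖x‖ ≤ M → δ ≤ gaussianDensity S θ x := by
  obtain ⟨K, hK, h⟩ := exists_mahalanobisSq_bounds hS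
  have := hS.det_pos
  refine ⟨(Real.sqrt ((2 * Real.pi) ^ k * S.det))⁻¹ * Real.exp (-(K * (2 * M) ^ 2) / 2),
    by positivity, fun θ x hθ hx => ?_⟩
  unfold gaussianDensity
  gcongr
  refine (h _).1.trans ?_
  gcongr
  linarith [norm_sub_le x θ]

/-- For `‖θ‖ ≤ 1`, `‖θ‖ ≤ ‖θ‖^d` since `d ≤ 1`; for `‖θ‖ ≥ 1`, Gaussian decay bounds the left side
while `‖θ‖^d ≥ 1`. -/
theorem exists_gaussianDensity_mul_norm_le (hS : S.PosDef) {d : ℝ} (hd0 : 0 ≤ d) (hd1 : d ≤ 1)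
    {M : ℝ} (hM : 0 ≤ M) : ∃ C : ℝ, 0 ≤ C ∧ ∀ θ x : Vec k, ‖x‖ ≤ M →
      gaussianDensity S θ x * ‖θ‖ ≤ C * ‖θ‖ ^ d := by
  obtain ⟨K, hK, h⟩ := exists_mahalanobisSq_bounds hS
  have := hS.det_pos
  set N := (Real.sqrt ((2 * Real.pi) ^ k * S.det))⁻¹ with hN
  have hN0 : 0 < N := by positivity
  refine ⟨N * (M + 2 * K + 1), by positivity, fun θ x hx => ?_⟩
  have hE0 := (Real.exp_pos (-(mahalanobisSq S (x - θ)) / 2)).le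
  have hE1 : Real.exp (-(mahalanobisSq S (x - θ)) / 2) ≤ 1 :=
    Real.exp_le_one_iff.2 (by linarith [mahalanobisSq_nonneg hS (x - θ)])
  rw [gaussianDensity, ← hN, mul_assoc, mul_assoc]
  refine mul_le_mul_of_nonneg_left ?_ hN0.le
  set m := mahalanobisSq S (x - θ) with hm
  have hm0 : 0 ≤ m := mahalanobisSq_nonneg hS _
  rcases le_total ‖θ‖ 1 with h1 | h1
  · have h2 : ‖θ‖ ≤ ‖θ‖ ^ d := by
      rcases (norm_nonneg θ).eq_or_lt with h0 | h0
      · rw [← h0]; positivity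
      · simpa using Real.rpow_le_rpow_of_exponent_ge h0 h1 hd1
    have h3 : 0 ≤ ‖θ‖ ^ d := by positivity
    calc Real.exp (-m / 2) * ‖θ‖ ≤ 1 * ‖θ‖ ^ d := by gcongr
      _ ≤ (M + 2 * K + 1) * ‖θ‖ ^ d := by gcongr; linarith
  · have h2 : 1 ≤ ‖θ‖ ^ d := Real.one_le_rpow h1 hd0
    -- Triangle inequality, then `t ≤ 1 + t²` with `t = ‖x - θ‖`.
    have h3 : ‖θ‖ ≤ M + 1 + K * m := by
      have h4 : ‖θ‖ ≤ ‖x‖ + ‖x - θ‖ := by simpa using norm_sub_le x (x - θ)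
      nlinarith [(h (x - θ)).2, sq_nonneg (‖x - θ‖ - 1)]
    have h5 : Real.exp (-m / 2) * m ≤ 2 := by
      have h6 : m / 2 ≤ Real.exp (m / 2) := (by linarith [Real.add_one_le_exp (m / 2)])
      have h7 : Real.exp (-m / 2) * Real.exp (m / 2) = 1 := by
        rw [← Real.exp_add, neg_div, neg_add_cancel, Real.exp_zero]
      nlinarith [Real.exp_pos (-m / 2)]
    calc Real.exp (-m / 2) * ‖θ‖ ≤ Real.exp (-m / 2) * (M + 1 + K * m) := by gcongr
      _ = Real.exp (-m / 2) * (M + 1) + K * (Real.exp (-m / 2) * m) := by ring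
      _ ≤ 1 * (M + 1) + K * 2 := by gcongr
      _ = (M + 2 * K + 1) * 1 := by ring
      _ ≤ _ := by gcongr

end density

/-! ### The posterior -/

section posterior

variable {k : ℕ} {S : Matrix (Fin k) (Fin k) ℝ} {d : ℝ}

theorem evidence_ne_zero (hk : 0 < k) (hS : S.PosDef) (hd : 0 < d) {c : ℝ} (hc : 0 < c)
    (x : Vec k) : evidence S d c x ≠ 0 := by
  have := isProbabilityMeasure_prior hk hS hd hc
  rw [evidence, lintegral_eq_zero_iff (measurable_gaussianDensity hS x) |>.ne]
  intro h
  have h1 : ∀ᵐ θ ∂(prior S d c), False := by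
    filter_upwards [h] with θ hθ
    exact absurd (ENNReal.ofReal_eq_zero.1 hθ) (gaussianDensity_pos hS θ x).not_ge
  exact h1.exists.elim fun _ => id

theorem evidence_ne_top (hk : 0 < k) (hS : S.PosDef) (hd : 0 < d) {c : ℝ} (hc : 0 < c)
    (x : Vec k) : evidence S d c x ≠ ∞ := by
  have := isProbabilityMeasure_prior hk hS hd hc
  refine ne_top_of_le_ne_top ?_
    (lintegral_mono fun θ => ENNReal.ofReal_le_ofReal (gaussianDensity_le hS θ x))
  simp

theorem isProbabilityMeasure_posterior (hk : 0 < k) (hS : S.PosDef) (hd : 0 < d) {c : ℝ}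
    (hc : 0 < c) (x : Vec k) : IsProbabilityMeasure (posterior S d c x) := by
  refine ⟨?_⟩
  rw [posterior, Measure.smul_apply, withDensity_apply _ .univ, setLIntegral_univ, smul_eq_mul]
  exact ENNReal.inv_mul_cancel (evidence_ne_zero hk hS hd hc x) (evidence_ne_top hk hS hd hc x)

theorem posterior_absolutelyContinuous (hk : 0 < k) (hS : S.PosDef) (hd : 0 < d) {c : ℝ}
    (hc : 0 < c) (x : Vec k) : posterior S d c x ≪ volume :=
  (((withDensity_absolutelyContinuous _ _).smul_left _).trans
    (prior_absolutelyContinuous hk hS hd hc))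

theorem posteriorBallProb_radius (hk : 0 < k) (hS : S.PosDef) (hd : 0 < d) {c : ℝ}
    (hc : 0 < c) {α : ℝ} (hα0 : 0 < α) (hα1 : α < 1) (x : Vec k) :
    posteriorBallProb S d c x (radius S d c α x) = 1 - α := by
  have := isProbabilityMeasure_posterior hk hS hd hc x
  have hm := measurable_mahalanobisSq hS
  exact measureReal_le_sInf_eq (posterior S d c x)
    (g := fun θ => mahalanobisSq S (θ - posteriorMean S d c x)) (by fun_prop)
    (fun r => posterior_absolutelyContinuous hk hS hd hc x
      (volume_mahalanobisSq_sub_eq hk hS _ r)) (by linarith) (by linarith)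

theorem lintegral_norm_rpow_prior (hk : 0 < k) (hS : S.PosDef) (hd : 0 < d) {c : ℝ}
    (hc : 0 < c) : ∫⁻ θ, ENNReal.ofReal (‖θ‖ ^ d) ∂(prior S d c) =
      ENNReal.ofReal (c ^ (d / 2)) * ∫⁻ θ, ENNReal.ofReal (‖θ‖ ^ d) ∂(prior S d 1) := by
  rw [prior_eq_map hk hS hd hc, lintegral_map (by fun_prop) (by fun_prop),
    ← lintegral_const_mul _ (by fun_prop)]
  refine lintegral_congr fun θ => ?_
  rw [← ENNReal.ofReal_mul (by positivity), norm_smul, Real.norm_of_nonneg (Real.sqrt_nonneg _),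
    Real.mul_rpow (by positivity) (by positivity), Real.sqrt_eq_rpow, ← Real.rpow_mul hc.le]
  congr 3
  ring

/-- The evidence stays explicit so that the bound holds for all `c > 0`, giving integrability; a
lower bound on it for `c ≤ 1` then gives the rate. -/
theorem lintegral_norm_posterior_le (hk : 0 < k) (hS : S.PosDef) (hd0 : 0 < d) (hd1 : d ≤ 1)
    {M : ℝ} (hM : 0 ≤ M) : ∃ C : ℝ≥0∞, C ≠ ∞ ∧ ∀ c, 0 < c → ∀ x : Vec k, ‖x‖ ≤ M →
      ∫⁻ θ, ENNReal.ofReal ‖θ‖ ∂(posterior S d c x) ≤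
        (evidence S d c x)⁻¹ * (C * ENNReal.ofReal (c ^ (d / 2))) := by
  obtain ⟨C, hC, h⟩ := exists_gaussianDensity_mul_norm_le hS hd0.le hd1 hM
  refine ⟨ENNReal.ofReal C * ∫⁻ θ, ENNReal.ofReal (‖θ‖ ^ d) ∂(prior S d 1),
    (ENNReal.mul_lt_top ENNReal.ofReal_lt_top
      (lintegral_norm_rpow_prior_lt_top hk hS hd0 hd1)).ne, fun c hc x hx => ?_⟩
  rw [posterior, lintegral_smul_measure, smul_eq_mul,
    lintegral_withDensity_eq_lintegral_mul _ (measurable_gaussianDensity hS x) (by fun_prop)]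
  gcongr
  calc _ ≤ ∫⁻ θ, ENNReal.ofReal C * ENNReal.ofReal (‖θ‖ ^ d) ∂(prior S d c) := by
        refine lintegral_mono fun θ => ?_
        rw [Pi.mul_apply, ← ENNReal.ofReal_mul (gaussianDensity_pos hS θ x).le,
          ← ENNReal.ofReal_mul hC]
        exact ENNReal.ofReal_le_ofReal (h θ x hx)
    _ = _ := by
        rw [lintegral_const_mul _ (by fun_prop), lintegral_norm_rpow_prior hk hS hd0 hc]
        ring

theorem integrable_posterior (hk : 0 < k) (hS : S.PosDef) (hd0 : 0 < d) (hd1 : d ≤ 1) {c : ℝ}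
    (hc : 0 < c) (x : Vec k) : Integrable (fun θ => θ) (posterior S d c x) := by
  obtain ⟨C, hC, h⟩ := lintegral_norm_posterior_le hk hS hd0 hd1 (norm_nonneg x)
  refine ⟨by fun_prop, ?_⟩
  rw [hasFiniteIntegral_iff_norm]
  exact (h c hc x le_rfl).trans_lt (ENNReal.mul_lt_top
    (ENNReal.inv_lt_top.2 (pos_iff_ne_zero.2 (evidence_ne_zero hk hS hd0 hc x)))
    (ENNReal.mul_lt_top hC.lt_top ENNReal.ofReal_lt_top))

/-- For `c ≤ 1` the dilation by `√c` maps a centred ball into itself, so its prior mass is at least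
that at `c = 1`; the density is bounded below there. -/
theorem exists_le_evidence (hk : 0 < k) (hS : S.PosDef) (hd : 0 < d) (M : ℝ) :
    ∃ e : ℝ≥0∞, e ≠ 0 ∧ ∀ c, 0 < c → c ≤ 1 → ∀ x : Vec k, ‖x‖ ≤ M → e ≤ evidence S d c x := by
  have := isProbabilityMeasure_prior hk hS hd one_pos
  obtain ⟨R, hR, hpR⟩ := exists_lt_measure_closedBall (prior S d 1) zero_lt_one
  obtain ⟨δ, hδ, h⟩ := exists_gaussianDensity_ge hS (max R M)
  refine ⟨ENNReal.ofReal δ * prior S d 1 (Metric.closedBall 0 R), ?_, fun c hc hc1 x hx => ?_⟩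
  · exact mul_ne_zero (ENNReal.ofReal_pos.2 hδ).ne' hpR.ne'
  have hsub : prior S d 1 (Metric.closedBall 0 R) ≤ prior S d c (Metric.closedBall 0 R) := by
    rw [prior_eq_map hk hS hd hc, Measure.map_apply (by fun_prop)
      Metric.isClosed_closedBall.measurableSet]
    refine measure_mono fun θ hθ => ?_
    rw [mem_closedBall_zero_iff] at hθ
    rw [Set.mem_preimage, mem_closedBall_zero_iff, norm_smul,
      Real.norm_of_nonneg (Real.sqrt_nonneg _)]
    exact (mul_le_of_le_one_left (norm_nonneg _) (Real.sqrt_le_one.2 hc1)).trans hθ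
  calc _ ≤ ENNReal.ofReal δ * prior S d c (Metric.closedBall 0 R) := by gcongr
    _ = ∫⁻ θ in Metric.closedBall 0 R, ENNReal.ofReal δ ∂(prior S d c) := by simp
    _ ≤ ∫⁻ θ in Metric.closedBall 0 R, ENNReal.ofReal (gaussianDensity S θ x) ∂(prior S d c) := by
        refine setLIntegral_mono (measurable_gaussianDensity hS x) fun θ hθ => ?_
        exact ENNReal.ofReal_le_ofReal (h θ x ((mem_closedBall_zero_iff.1 hθ).trans
          (le_max_left _ _)) (hx.trans (le_max_right _ _)))
    _ ≤ evidence S d c x := setLIntegral_le_lintegral _ _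

theorem exists_norm_posteriorMean_le (hk : 0 < k) (hS : S.PosDef) (hd0 : 0 < d) (hd1 : d ≤ 1)
    {M : ℝ} (hM : 0 ≤ M) : ∃ C : ℝ, 0 ≤ C ∧ ∀ c, 0 < c → c ≤ 1 → ∀ x : Vec k, ‖x‖ ≤ M →
      ‖posteriorMean S d c x‖ ≤ C * c ^ (d / 2) := by
  obtain ⟨C, hC, h⟩ := lintegral_norm_posterior_le hk hS hd0 hd1 hM
  obtain ⟨e, he, h'⟩ := exists_le_evidence hk hS hd0 M
  have hfin : e⁻¹ * C ≠ ∞ := ENNReal.mul_ne_top (ENNReal.inv_ne_top.2 he) hC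
  refine ⟨(e⁻¹ * C).toReal, ENNReal.toReal_nonneg, fun c hc hc1 x hx => ?_⟩
  refine (norm_integral_le_lintegral_norm _).trans (ENNReal.toReal_le_of_le_ofReal
    (by positivity) ((h c hc x hx).trans ?_))
  rw [ENNReal.ofReal_mul ENNReal.toReal_nonneg, ENNReal.ofReal_toReal hfin, mul_assoc]
  gcongr
  exact h' c hc hc1 x hx

/-! ### Anticoncentration -/

/-- Uniformity in the centre comes from absolute continuity of the integral of the prior density:
small volume forces small mass, and the volume of a ball is independent of its centre. It is needed
because the posterior mean moves with `c` and `x`. -/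
theorem exists_prior_ball_lt (hk : 0 < k) (hS : S.PosDef) (hd : 0 < d) {η : ℝ≥0∞} (hη : η ≠ 0) :
    ∃ ε : ℝ, 0 < ε ∧ ∀ a : Vec k, prior S d 1 {θ | mahalanobisSq S (θ - a) ≤ ε} < η := by
  have := isProbabilityMeasure_prior hk hS hd one_pos
  have hac := prior_absolutelyContinuous hk hS hd one_pos
  obtain ⟨K, hK, hb⟩ := exists_mahalanobisSq_bounds hS
  have hf : ∫⁻ θ, (prior S d 1).rnDeriv volume θ ≠ ∞ :=
    (Measure.lintegral_rnDeriv_lt_top _ _).ne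
  obtain ⟨δ, hδ, h⟩ := exists_pos_setLIntegral_lt_of_measure_lt hf hη
  have hV : volume (Metric.ball (0 : Vec k) 1) ≠ ∞ := measure_ball_lt_top.ne
  have ht : Tendsto (fun ε : ℝ => ENNReal.ofReal (Real.sqrt (K * ε) ^ k) *
      volume (Metric.ball (0 : Vec k) 1)) (𝓝[>] 0) (𝓝 0) := by
    have h1 : Tendsto (fun ε : ℝ => ENNReal.ofReal (Real.sqrt (K * ε) ^ k)) (𝓝[>] 0) (𝓝 0) := by
      have h2 : Continuous fun ε : ℝ => ENNReal.ofReal (Real.sqrt (K * ε) ^ k) :=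
        ENNReal.continuous_ofReal.comp (by fun_prop)
      simpa [hk.ne'] using (h2.tendsto 0).mono_left nhdsWithin_le_nhds
    simpa using ENNReal.Tendsto.mul_const h1 (Or.inr hV)
  obtain ⟨ε, hε, hε0⟩ := ((ht.eventually_lt_const hδ).and self_mem_nhdsWithin).exists
  refine ⟨ε, hε0, fun a => ?_⟩
  rw [← Measure.withDensity_rnDeriv_eq _ _ hac]
  have hm := measurable_mahalanobisSq hS
  rw [withDensity_apply _ (measurableSet_le (by fun_prop) measurable_const)]
  refine h _ (lt_of_le_of_lt (measure_mono
    (t := Metric.closedBall a (Real.sqrt (K * ε))) fun θ hθ => ?_) ?_)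
  · rw [mem_closedBall_iff_norm]
    exact Real.le_sqrt_of_sq_le ((hb _).2.trans (mul_le_mul_of_nonneg_left hθ hK.le))
  · rwa [Measure.addHaar_closedBall _ _ (Real.sqrt_nonneg _), finrank_euclideanSpace_fin]

theorem prior_ball_eq (hk : 0 < k) (hS : S.PosDef) (hd : 0 < d) {c : ℝ} (hc : 0 < c) (a : Vec k)
    (ε : ℝ) : prior S d c {θ | mahalanobisSq S (θ - a) ≤ ε * c} =
      prior S d 1 {θ | mahalanobisSq S (θ - (Real.sqrt c)⁻¹ • a) ≤ ε} := by
  have hm := measurable_mahalanobisSq hS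
  rw [prior_eq_map hk hS hd hc, Measure.map_apply (by fun_prop)
    (measurableSet_le (by fun_prop) measurable_const)]
  congr 1
  ext θ
  have h0 : Real.sqrt c ≠ 0 := (Real.sqrt_pos.2 hc).ne'
  have h : Real.sqrt c • θ - a = Real.sqrt c • (θ - (Real.sqrt c)⁻¹ • a) := by
    rw [smul_sub, smul_smul, mul_inv_cancel₀ h0, one_smul]
  rw [Set.mem_preimage, Set.mem_ofPred_eq, Set.mem_ofPred_eq, h, mahalanobisSq_smul,
    Real.sq_sqrt hc.le, mul_comm c, mul_le_mul_iff_left₀ hc]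

theorem exists_le_radius (hk : 0 < k) (hS : S.PosDef) (hd : 0 < d) {α : ℝ} (hα0 : 0 < α)
    (hα1 : α < 1) (M : ℝ) : ∃ ε : ℝ, 0 < ε ∧ ∀ c, 0 < c → c ≤ 1 → ∀ x : Vec k, ‖x‖ ≤ M →
      ε * c ≤ radius S d c α x := by
  obtain ⟨e, he, h'⟩ := exists_le_evidence hk hS hd M
  set N := ENNReal.ofReal (Real.sqrt ((2 * Real.pi) ^ k * S.det))⁻¹ with hN
  have hp : 0 < (1 - α) / 2 := by linarith
  have hA : e⁻¹ * N ≠ ∞ := ENNReal.mul_ne_top (ENNReal.inv_ne_top.2 he) ENNReal.ofReal_ne_top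
  -- `e⁻¹ * N` bounds the posterior-to-prior density, so this `η` caps the posterior mass at `(1 -
  -- α) / 2`, below the exact value `1 - α` at the radius.
  obtain ⟨ε, hε, h⟩ := exists_prior_ball_lt hk hS hd
    (η := ENNReal.ofReal ((1 - α) / 2) / (e⁻¹ * N))
    (ENNReal.div_ne_zero.2 ⟨(ENNReal.ofReal_pos.2 hp).ne', hA⟩)
  refine ⟨ε, hε, fun c hc hc1 x hx => ?_⟩
  have := isProbabilityMeasure_posterior hk hS hd hc x
  have hm := measurable_mahalanobisSq hS
  by_contra! hlt
  have h1 := posteriorBallProb_radius hk hS hd hc hα0 hα1 x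
  set a := posteriorMean S d c x with ha
  have h2 : posterior S d c x {θ | mahalanobisSq S (θ - a) ≤ ε * c} ≤
      ENNReal.ofReal ((1 - α) / 2) := by
    have hms : MeasurableSet {θ | mahalanobisSq S (θ - a) ≤ ε * c} :=
      measurableSet_le (by fun_prop) measurable_const
    rw [posterior, Measure.smul_apply, withDensity_apply _ hms, smul_eq_mul]
    calc _ ≤ e⁻¹ * ∫⁻ θ in {θ | mahalanobisSq S (θ - a) ≤ ε * c}, N ∂(prior S d c) := by
          gcongr with θ
          · exact h' c hc hc1 x hx
          · exact ENNReal.ofReal_le_ofReal (gaussianDensity_le hS θ x)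
      _ = e⁻¹ * N * prior S d c {θ | mahalanobisSq S (θ - a) ≤ ε * c} := by
          rw [setLIntegral_const, mul_assoc]
      _ ≤ e⁻¹ * N * (ENNReal.ofReal ((1 - α) / 2) / (e⁻¹ * N)) := by
          rw [prior_ball_eq hk hS hd hc]
          gcongr
          exact (h _).le
      _ ≤ _ := ENNReal.mul_div_le
  have h3 : posteriorBallProb S d c x (radius S d c α x) ≤ (1 - α) / 2 := by
    refine ENNReal.toReal_le_of_le_ofReal hp.le ((measure_mono fun θ hθ => ?_).trans h2)
    exact le_trans hθ hlt.le
  linarith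

/-! ### Coverage -/

theorem eventually_zero_mem_credibleSet (hk : 0 < k) (hS : S.PosDef) (hd0 : 0 < d) (hd1 : d ≤ 1)
    {α ρ L : ℝ} (hα0 : 0 < α) (hα1 : α < 1) (hρ : 0 < ρ) (hL : 0 < L) {M : ℝ} (hM : 0 ≤ M) :
    ∀ᶠ c in 𝓝[>] (0 : ℝ), ∀ x : Vec k, ‖x‖ ≤ M → 0 ∈ credibleSet S d c α ρ L x := by
  obtain ⟨K, hK, hb⟩ := exists_mahalanobisSq_bounds hS
  obtain ⟨C, hC, hmean⟩ := exists_norm_posteriorMean_le hk hS hd0 hd1 hM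
  obtain ⟨ε, hε, hrad⟩ := exists_le_radius hk hS hd0 hα0 hα1 M
  set s := d / (1 + ρ) with hs
  have hs0 : 0 < s := by positivity
  have hsd : s < d := by rw [hs, div_lt_iff₀ (by positivity)]; nlinarith
  -- The ratio of the squared bias `c^d` to the threshold order `c^s`; it vanishes since `ρ > 0`
  -- makes `s < d`.
  have ht : Tendsto (fun c : ℝ => K * C ^ 2 * c ^ (d - s)) (𝓝[>] 0) (𝓝 0) := by
    have h1 : Continuous fun c : ℝ => c ^ (d - s) :=
      Real.continuous_rpow_const (by linarith)
    have h2 := ((h1.tendsto 0).const_mul (K * C ^ 2)).mono_left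
      (nhdsWithin_le_nhds (s := Set.Ioi 0))
    rwa [Real.zero_rpow (by linarith), mul_zero] at h2
  have hpos : 0 < L * ε ^ s := by positivity
  filter_upwards [ht.eventually_lt_const hpos, self_mem_nhdsWithin,
    nhdsWithin_le_nhds (Iic_mem_nhds one_pos)] with c hc hc0 hc1 x hx
  have hc0' : (0 : ℝ) < c := hc0
  change mahalanobisSq S (0 - posteriorMean S d c x) ≤ L * radius S d c α x ^ s
  calc mahalanobisSq S (0 - posteriorMean S d c x) ≤ K * ‖posteriorMean S d c x‖ ^ 2 := by
        simpa using (hb (0 - posteriorMean S d c x)).1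
    _ ≤ K * (C * c ^ (d / 2)) ^ 2 := by gcongr; exact hmean c hc0 hc1 x hx
    _ = K * C ^ 2 * c ^ (d - s) * c ^ s := by
        rw [mul_assoc _ (c ^ (d - s)), ← Real.rpow_add hc0', mul_pow, ← Real.rpow_natCast (c ^ _),
          ← Real.rpow_mul hc0'.le, ← mul_assoc]
        congr 2
        push_cast
        ring
    _ ≤ L * ε ^ s * c ^ s := by gcongr
    _ = L * (ε * c) ^ s := by rw [Real.mul_rpow hε.le hc0'.le, mul_assoc]
    _ ≤ L * radius S d c α x ^ s := by gcongr; exact hrad c hc0 hc1 x hx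

theorem le_coverage {n : ℕ} {c α ρ L M p : ℝ} {θ₀ : Fin n → Vec k} {i : Fin n} (hi : θ₀ i = 0)
    (h : ∀ x : Vec k, ‖x‖ ≤ M → 0 ∈ credibleSet S d c α ρ L x)
    (hp : p ≤ (multivariateGaussian 0 S).real (Metric.closedBall (0 : Vec k) M)) :
    p ≤ coverage S d c α ρ L θ₀ i := by
  have hmp : MeasurePreserving (Function.eval i) (dataLaw S θ₀) (multivariateGaussian (θ₀ i) S) :=
    measurePreserving_eval _ i
  have : IsProbabilityMeasure (dataLaw S θ₀) := by unfold dataLaw; infer_instance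
  rw [← hi, ← hmp.map_eq, map_measureReal_apply (by fun_prop)
    Metric.isClosed_closedBall.measurableSet] at hp
  -- Only an inclusion of events is used, so measurability of the coverage event is not needed.
  refine hp.trans (measureReal_mono fun X hX => ?_)
  rw [Set.mem_preimage, hi, mem_closedBall_zero_iff] at hX
  rw [Set.mem_ofPred_eq, hi]
  exact h _ hX

/-- The gamma law charges no negative half-line. This turns the lower bound on `L` into `0 < L`. -/
theorem chiSqUpperQuantile_nonneg (k : ℕ) {α : ℝ} (hα : α < 1) : 0 ≤ chiSqUpperQuantile k α := by
  refine Real.sInf_nonneg fun t ht => ?_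
  by_contra! h
  have h0 : gammaMeasure ((k : ℝ) / 2) (1 / 2) (Set.Iic t) = 0 := by
    rw [gammaMeasure, withDensity_apply _ measurableSet_Iic]
    exact le_antisymm ((lintegral_mono_set (Set.Iic_subset_Iio.2 h)).trans_eq
      (lintegral_gammaPDF_of_nonpos le_rfl)) zero_le
  rw [Set.mem_ofPred_eq, measureReal_def, h0, ENNReal.toReal_zero] at ht
  linarith

end posterior

end EIG

theorem mainTheorem9 (k : ℕ) (hk : 0 < k)
    (S : Matrix (Fin k) (Fin k) ℝ) (hS : S.PosDef)
    (d : ℝ) (hd0 : 0 < d) (hd1 : d < 1)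
    (c : ℕ → ℝ) (hc_pos : ∀ n, 0 < c n) (hc_lim : Tendsto c atTop (𝓝 0))
    (α β ρ L : ℝ) (hα0 : 0 < α) (hα : α < 1 / 2) (hαβ : α < β) (hβ : β < 1) (hρ : 0 < ρ)
    (hL : EIG.chiSqUpperQuantile k α * EIG.chiSqUpperQuantile k β ^ (-(d / (1 + ρ))) < L)
    (q : ℕ → ℝ) (hq : q =o[atTop] fun n : ℕ => (n : ℝ))
    (θ₀ : (n : ℕ) → Fin n → EIG.Vec k)
    (hθ₀ : ∀ n, θ₀ n ∈ EIG.nearlyBlack k n (q n)) :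
    (∀ (n : ℕ) (x : EIG.Vec k),
      IsProbabilityMeasure (EIG.posterior S d (c n) x) ∧
      Integrable (fun θ => θ) (EIG.posterior S d (c n) x) ∧
      EIG.posteriorBallProb S d (c n) x (EIG.radius S d (c n) α x) = 1 - α) ∧
    ∃ B : (n : ℕ) → Finset (Fin n),
      (fun n => ((B n).card : ℝ)) =o[atTop] (fun n : ℕ => (n : ℝ)) ∧
      ∀ᶠ n in atTop, ∀ i : Fin n, i ∉ B n →
        1 - α ≤ EIG.coverage S d (c n) α ρ L (θ₀ n) i := by
  have hα1 : α < 1 := by linarith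
  refine ⟨fun n x => ⟨EIG.isProbabilityMeasure_posterior hk hS hd0 (hc_pos n) x,
    EIG.integrable_posterior hk hS hd0 hd1.le (hc_pos n) x,
    EIG.posteriorBallProb_radius hk hS hd0 (hc_pos n) hα0 hα1 x⟩,
    fun n => Finset.univ.filter fun i => θ₀ n i ≠ 0, ?_, ?_⟩
  · refine IsBigO.trans_isLittleO (IsBigO.of_bound 1 (Eventually.of_forall fun n => ?_)) hq
    rw [one_mul, Real.norm_of_nonneg (Nat.cast_nonneg _)]
    exact (hθ₀ n).trans (le_abs_self _)
  have hL0 : 0 < L := lt_of_le_of_lt (mul_nonneg (EIG.chiSqUpperQuantile_nonneg k hα1)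
    (Real.rpow_nonneg (EIG.chiSqUpperQuantile_nonneg k hβ) _)) hL
  -- `α > 0` leaves room for a bounded ball of mass above `1 - α`; `M` depends on neither `n` nor
  -- `i`, so one threshold for `n` serves all null indices.
  obtain ⟨M, hM, hMp⟩ := EIG.exists_lt_measure_closedBall (multivariateGaussian 0 S)
    (p := ENNReal.ofReal (1 - α)) (by simpa using hα0)
  have hp : 1 - α ≤ (multivariateGaussian 0 S).real (Metric.closedBall (0 : EIG.Vec k) M) :=
    (ENNReal.ofReal_le_iff_le_toReal (measure_ne_top _ _)).1 hMp.le
  have hc : Tendsto c atTop (𝓝[>] 0) :=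
    tendsto_nhdsWithin_iff.2 ⟨hc_lim, Eventually.of_forall hc_pos⟩
  filter_upwards [hc.eventually
    (EIG.eventually_zero_mem_credibleSet hk hS hd0 hd1.le hα0 hα1 hρ hL0 hM)] with n hn i hi
  exact EIG.le_coverage (by simpa using hi) hn hp
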